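/- Work over $\mathbb{C}$. A homogeneous polynomial $F(x_1,\dots,x_k)$ is called smooth if its partial derivatives have no common zero in $\mathbb{C}^k$ other than $0$. For an integer $d\ge 3$ and $k\ge 1$, the polynomial $x_1^{d-1}x_2+x_2^{d-1}x_3+\cdots+x_k^{d-1}x_1$ is said to be of type $K_k$, and the polynomial $x_1^{d-1}x_2+\cdots+x_{k-1}^{d-1}x_k+x_k^d$ of type $T_k$. A simple polynomial of degree $d$ is a sum of finitely many (at least one) polynomials of types $K_k$ and $T_k$ (its components), of the same degree $d$ and in pairwise disjoint sets of variables; a component is of type $T_{\ge 2}$ if it is of type $T_k$ with $k\ge 2$. For a polynomial $F_0(x_1,\dots,x_n)$, let $G_{F_0}\subset \mathrm{PGL}(n,\mathbb{C})$ be the group of classes of diagonal matrices $\mathrm{diag}(t_1,\dots,t_n)$, $t_i\in\mathbb{C}^\times$, such that $F_0(t_1x_1,\dots,t_nx_n)=c\,F_0(x_1,\dots,x_n)$ for some $c\in\mathbb{C}^\times$. **Theorem.** Let $d\ge 3$ and $N\ge 3$ be integers, let $F(x_1,\dots,x_N)$ be a smooth homogeneous polynomial of degree $d$, and let $V(F)\subset\mathbb{P}^{N-1}$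 be the smooth hypersurface it defines. Let $G$ be a finite abelian group acting faithfully and linearly on $V(F)$, that is, with an injective homomorphism from $G$ to the group of elements of $\mathrm{PGL}(N,\mathbb{C})$ that map $V(F)$ onto itself. Suppose that the action is liftable, that is, that $G\to \mathrm{PGL}(N,\mathbb{C})$ is the composition of a homomorphism $G\to \mathrm{GL}(N,\mathbb{C})$ with the projection $\mathrm{GL}(N,\mathbb{C})\to\mathrm{PGL}(N,\mathbb{C})$. Assume that $G=G_1\oplus G_2$ with $G_1$ cyclic and $\gcd(|G_2|,d-1)=1$. Then there are an integer $N_0$ with $1\le N_0\le N$ and a simple polynomial $F_0(x_1,\dots,x_{N_0})$ of degree $d$, involving all $N_0$ variables, such that $F_0$ has at most one component of type $T_{\ge2}$ and $G$ is isomorphic to a subgroup of $G_{F_0}$. If $\gcd(|G|,d-1)\ne 1$, then $F_0$ can be chosen with exactly one component of type $T_{\ge2}$. -/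

import Mathlib

open scoped LinearAlgebra.Projectivization MatrixGroups Pointwise

noncomputable section

namespace SmoothHypersurface

/-- A homogeneous polynomial in `x₁, …, x_N` is smooth if its partial derivatives have no common
zero in `ℂ^N` other than the origin. -/
def IsSmooth {N : ℕ} (F : MvPolynomial (Fin N) ℂ) : Prop :=
  ∀ x : Fin N → ℂ, (∀ i, MvPolynomial.eval x (MvPolynomial.pderiv i F) = 0) → x = 0

/-- The hypersurface `V(F)` in the projective space `ℙ^{N-1}`: the lines through the origin
on which `F` vanishes. -/
def hypersurface {N : ℕ} (F : MvPolynomial (Fin N) ℂ) : Set (ℙ ℂ (Fin N → ℂ)) :=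
  {p | ∀ v ∈ p.submodule, MvPolynomial.eval v F = 0}

/-- The group `Lin(V(F))` of linear automorphisms of `V(F)`: the elements of `PGL(N, ℂ)`
that map `V(F)` onto itself. -/
def linAut {N : ℕ} (F : MvPolynomial (Fin N) ℂ) : Subgroup PGL(N, ℂ) :=
  MulAction.stabilizer PGL(N, ℂ) (hypersurface F)

/-- A projective representation `G → PGL(N, ℂ)` is liftable if it is the composition of a group
homomorphism `G → GL(N, ℂ)` with the projection `GL(N, ℂ) → PGL(N, ℂ)`. -/
def IsLiftable {G : Type*} [Group G] {N : ℕ} (ρ : G →* PGL(N, ℂ)) : Prop :=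
  ∃ j : G →* GL (Fin N) ℂ, Matrix.ProjGenLinGroup.mk.comp j = ρ

/-- The diagonal matrix `diag(t₁, …, t_N)` as an element of `GL(N, ℂ)`. -/
def diagGL (N : ℕ) : (Fin N → ℂˣ) →* GL (Fin N) ℂ :=
  (Units.map (Matrix.diagonalRingHom (Fin N) ℂ).toMonoidHom).comp
    (MulEquiv.piUnits (M := fun _ : Fin N => ℂ)).symm.toMonoidHom

/-- The polynomial `F(t₁ x₁, …, t_N x_N)`. -/
def rescale {N : ℕ} (t : Fin N → ℂˣ) (F : MvPolynomial (Fin N) ℂ) : MvPolynomial (Fin N) ℂ :=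
  MvPolynomial.aeval (fun i => MvPolynomial.C (t i : ℂ) * MvPolynomial.X i) F

lemma rescale_one {N : ℕ} (F : MvPolynomial (Fin N) ℂ) : rescale 1 F = F := by
  simp [rescale]

lemma rescale_mul {N : ℕ} (s t : Fin N → ℂˣ) (F : MvPolynomial (Fin N) ℂ) :
    rescale (s * t) F = rescale s (rescale t F) := by
  induction F using MvPolynomial.induction_on with
  | C a => simp [rescale]
  | add p q hp hq => simp only [rescale, map_add] at *; rw [hp, hq]
  | mul_X p i hp =>
    simp only [rescale, map_mul, MvPolynomial.aeval_X, MvPolynomial.aeval_C] at *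
    rw [hp]
    simp only [Pi.mul_apply, Units.val_mul, map_mul, MvPolynomial.algebraMap_eq]
    ring

lemma rescale_smul {N : ℕ} (t : Fin N → ℂˣ) (c : ℂˣ) (F : MvPolynomial (Fin N) ℂ) :
    rescale t (c • F) = c • rescale t F := by
  simp [rescale, Units.smul_def]

/-- The tuples `(t₁, …, t_N)` of nonzero numbers with `F(t₁ x₁, …, t_N x_N) = c F(x₁, …, x_N)`
for some `c ≠ 0`. -/
def diagSemiInvariance {N : ℕ} (F : MvPolynomial (Fin N) ℂ) : Subgroup (Fin N → ℂˣ) where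
  carrier := {t | ∃ c : ℂˣ, rescale t F = c • F}
  one_mem' := ⟨1, by simp [rescale_one]⟩
  mul_mem' := by
    rintro s t ⟨a, ha⟩ ⟨b, hb⟩
    exact ⟨b * a, by rw [rescale_mul, hb, rescale_smul, ha, mul_smul]⟩
  inv_mem' := by
    rintro t ⟨a, ha⟩
    refine ⟨a⁻¹, ?_⟩
    have h : rescale t⁻¹ (rescale t F) = F := by
      rw [← rescale_mul, inv_mul_cancel, rescale_one]
    rw [ha, rescale_smul] at h
    exact eq_inv_smul_iff.mpr h

/-- The group `G_F` of diagonal automorphisms of `V(F)`: the classes in `PGL(N, ℂ)` of the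
diagonal matrices `diag(t₁, …, t_N)` with `F(t₁ x₁, …, t_N x_N) = c F(x₁, …, x_N)` for
some `c ≠ 0`. -/
def diagAut {N : ℕ} (F : MvPolynomial (Fin N) ℂ) : Subgroup PGL(N, ℂ) :=
  (diagSemiInvariance F).map (Matrix.ProjGenLinGroup.mk.comp (diagGL N))

/-- The polynomial `x₁^{d-1} x₂ + x₂^{d-1} x₃ + ⋯ + x_k^{d-1} x₁` of type `K_k`. The permutation
`finRotate k` sends each index to the next one and the last index to the first. -/
def polyK (d k : ℕ) : MvPolynomial (Fin k) ℂ :=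
  ∑ i : Fin k, MvPolynomial.X i ^ (d - 1) * MvPolynomial.X (finRotate k i)

/-- The polynomial `x₁^{d-1} x₂ + ⋯ + x_{k-1}^{d-1} x_k + x_k^d` of type `T_k`. -/
def polyT (d k : ℕ) : MvPolynomial (Fin k) ℂ :=
  ∑ i : Fin k,
    if h : (i : ℕ) + 1 < k then
      MvPolynomial.X i ^ (d - 1) * MvPolynomial.X ⟨(i : ℕ) + 1, h⟩
    else MvPolynomial.X i ^ d

/-- The possible types `K_k` and `T_k`, `k ≥ 1`, of the components of a simple polynomial. -/
inductive ComponentType where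
  | K (k : ℕ+)
  | T (k : ℕ+)

namespace ComponentType

/-- The number of variables of a component. -/
def size : ComponentType → ℕ
  | K k => k
  | T k => k

/-- The polynomial of degree `d` of a given type. -/
def poly (d : ℕ) : (c : ComponentType) → MvPolynomial (Fin c.size) ℂ
  | K k => polyK d k
  | T k => polyT d k

/-- The type is `T_k` with `k ≥ 2`. -/
def IsTGeTwo : ComponentType → Prop
  | K _ => False
  | T k => 2 ≤ (k : ℕ)

end ComponentType

/-- `F(x₁, …, x_n)` is a simple polynomial of degree `d` of type `τ₁ ⊕ ⋯ ⊕ τ_s`: the variables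
`x₁, …, x_n` are partitioned into ordered blocks, one for each `i = 1, …, s`, and `F` is the sum
over `i` of the polynomial of type `τ_i` in the variables of the `i`-th block. -/
def IsSimpleOfType (d : ℕ) {n s : ℕ} (τ : Fin s → ComponentType)
    (F : MvPolynomial (Fin n) ℂ) : Prop :=
  ∃ e : (Σ i : Fin s, Fin (τ i).size) ≃ Fin n,
    F = ∑ i : Fin s, MvPolynomial.rename (fun a => e ⟨i, a⟩) ((τ i).poly d)

/-- The number of components of type `T_k` with `k ≥ 2`. -/
def numTGeTwo {s : ℕ} (τ : Fin s → ComponentType) : ℕ :=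
  {i : Fin s | (τ i).IsTGeTwo}.ncard

end SmoothHypersurface

end

/-!
A lift of the action to `GL(N, ℂ)` is simultaneously diagonalizable. Since a smooth `F` is
squarefree, `F` is multiplied by a constant under every lifted automorphism
(`exists_linSubst_eq_smul`). Hence, in suitable coordinates, `G` acts on the variables through
characters `w i` and all monomials of `F` have the same weight `a` (`exists_weights`).

Consider the affine map `T x = a / x ^ (d - 1)` (`weightStep`) on the group of characters. A
polynomial of type `K_k` amounts to a cycle of `T` of length `k`, and one of type `T_k` to a chain
of `k` characters, each mapped to the next, that ends at a fixed point. A simple polynomial whose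
variables carry characters of `G` in this way, and on which `G` acts faithfully modulo scalars,
embeds `G` in `G_{F₀}` (`exists_simple_of_characters`). So cycles and a chain have to be found
among the characters of `G`, using at most `N` variables.

Smoothness is used through a count (`IsSmooth.card_weights_le`): for every subgroup `K` of
characters, the coset `T(v) K` contains at least as many of the weights as `v K`. Iterating `T`
sends each `w i` to a periodic point, and its periodic limit `z i` differs from `w i` by a
character killed by `(d - 1) ^ m`. By the hypothesis on `G`, the quotients `w i / z i` generate a
cyclic group, say with generator `β` (`isCyclic_of_le_depthSubgroup`). The cycles through the
`z i`, together with a chain of `m + 1` characters that starts at `c β` for a fixed point `c`,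
then separate the elements of `G` (`exists_simple_of_fixed_point`).

It remains to find `c` and to count variables. Take `m` minimal and choose `z i` with `w i` of
depth exactly `m`. By the count above, at least `m + 1` variables have limit `z i`, and as many
have limit `T (z i)` (`exists_periodic_limits`). If `z i` is fixed by `T`, it serves as `c`, and
the chain replaces the cycle `{z i}`. Otherwise the two families leave `2 m ≥ m + 1` variables
besides one for each periodic limit. There may be no fixed point among the characters of `G`, but
there is one on the extension of `G` by the `d`-th roots of `a`. The same construction applies to
that extension, which contains a copy of its quotient `G` by duality
(`exists_injective_of_surjective`). If `m = 0`, the cycles suffice; this happens only if `|G|` is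
prime to `d - 1`.
-/

namespace SmoothHypersurface

/-! ### Common zeros of polynomials -/

section CommonZeros

variable {K σ : Type*} [Field K]

open MvPolynomial in
theorem card_le_height_vanishingIdeal_zero [Fintype σ] :
    (Fintype.card σ : ℕ∞) ≤ (vanishingIdeal K {(0 : σ → K)}).height := by
  classical
  let e := Fintype.equivFin σ
  -- The ideal generated by the first `k` variables, as the kernel of the map killing them.
  let φ (k : ℕ) : MvPolynomial σ K →ₐ[K] MvPolynomial σ K :=
    aeval fun i => if (e i : ℕ) < k then 0 else X i
  have hprime (k : ℕ) : (RingHom.ker (φ k)).IsPrime := RingHom.ker_isPrime _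
  have key (k : ℕ) (hk : k ≤ Fintype.card σ) : (k : ℕ∞) ≤ (RingHom.ker (φ k)).height := by
    induction k with
    | zero => simp
    | succ k ih =>
      have hlt : RingHom.ker (φ k) < RingHom.ker (φ (k + 1)) := by
        refine lt_of_le_of_ne ?_ ?_
        · have hcomp : φ (k + 1) = (φ (k + 1)).comp (φ k) := by
            refine algHom_ext fun i => ?_
            by_cases h : (e i : ℕ) < k
            · simp [φ, h, h.le]
            · simp [φ, h]
          intro p hp
          rw [RingHom.mem_ker] at hp ⊢
          rw [hcomp, AlgHom.comp_apply, hp, map_zero]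
        · intro h
          have : X (e.symm ⟨k, hk⟩) ∈ RingHom.ker (φ k) := by
            rw [h, RingHom.mem_ker]
            simp [φ]
          rw [RingHom.mem_ker] at this
          simp [φ] at this
      push_cast
      exact (add_le_add_left (ih (Nat.le_of_succ_le hk)) 1).trans
        (Ideal.height_add_one_le_of_lt_of_isPrime hlt)
  refine (key _ le_rfl).trans (Ideal.height_mono fun p hp => ?_)
  rw [RingHom.mem_ker] at hp
  rw [mem_vanishingIdeal_singleton_iff]
  have h0 : (aeval (0 : σ → K) : MvPolynomial σ K →ₐ[K] K) =
      (aeval (0 : σ → K)).comp (φ (Fintype.card σ)) := by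
    refine algHom_ext fun i => ?_
    simp [φ]
  rw [h0, AlgHom.comp_apply, hp, map_zero]

/-- Fewer polynomials than variables, all vanishing at the origin, have a further common zero:
otherwise the origin would be an isolated point of their zero locus, against Krull's height
theorem. -/
theorem exists_ne_zero_forall_eval_eq_zero [IsAlgClosed K] [Fintype σ]
    (s : Finset (MvPolynomial σ K)) (hs : s.card < Fintype.card σ)
    (h0 : ∀ f ∈ s, MvPolynomial.eval 0 f = 0) :
    ∃ x : σ → K, x ≠ 0 ∧ ∀ f ∈ s, MvPolynomial.eval x f = 0 := by
  by_contra! hcon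
  set I : Ideal (MvPolynomial σ K) := Ideal.span s with hI
  have hloc : MvPolynomial.zeroLocus K I = {0} := by
    ext x
    rw [hI, MvPolynomial.zeroLocus_span]
    constructor
    · intro hx
      by_contra hne
      obtain ⟨f, hf, hfx⟩ := hcon x hne
      exact hfx (by simpa [MvPolynomial.aeval_eq_eval] using hx f hf)
    · rintro rfl f hf
      simpa [MvPolynomial.aeval_eq_eval] using h0 f hf
  have hrad := MvPolynomial.vanishingIdeal_zeroLocus_eq_radical (K := K) I
  rw [hloc] at hrad
  have hmin : MvPolynomial.vanishingIdeal K {(0 : σ → K)} ∈ I.minimalPrimes := by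
    refine ⟨⟨inferInstance, ?_⟩, fun J hJ _ => ?_⟩
    · rw [hrad]; exact Ideal.le_radical
    · rw [hrad]; exact hJ.1.radical_le_iff.2 hJ.2
  have h1 := Ideal.height_le_card_of_mem_minimalPrimes_span_finset hmin
  have h2 := (card_le_height_vanishingIdeal_zero (K := K) (σ := σ)).trans h1
  exact absurd (Nat.cast_le.1 h2) (by omega)

/-- A non-constant polynomial in at least two variables has a zero away from the origin. -/
theorem exists_ne_zero_eval_eq_zero [IsAlgClosed K] [Fintype σ] (hσ : 1 < Fintype.card σ)
    {p : MvPolynomial σ K} (hp : ¬ IsUnit p) : ∃ x : σ → K, x ≠ 0 ∧ MvPolynomial.eval x p = 0 := by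
  by_cases h0 : MvPolynomial.eval 0 p = 0
  · simpa using exists_ne_zero_forall_eval_eq_zero {p} (by simpa using hσ) (by simpa using h0)
  · by_contra! hcon
    have hloc : MvPolynomial.zeroLocus K (Ideal.span {p}) = ∅ := by
      ext x
      rw [MvPolynomial.zeroLocus_span]
      simp only [Set.mem_singleton_iff, forall_eq, Set.mem_ofPred_eq, Set.mem_empty_iff_false,
        iff_false, MvPolynomial.aeval_eq_eval]
      by_cases hx : x = 0
      · simpa [hx] using h0
      · simpa using hcon x hx
    have hrad := MvPolynomial.vanishingIdeal_zeroLocus_eq_radical (K := K) (Ideal.span {p})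
    rw [hloc, MvPolynomial.vanishingIdeal_empty] at hrad
    exact hp (Ideal.span_singleton_eq_top.1 (Ideal.radical_eq_top.1 hrad.symm))

end CommonZeros

/-! ### Smooth polynomials: reducedness and linear substitutions -/

section Smooth

variable {N d : ℕ} {F : MvPolynomial (Fin N) ℂ}

theorem IsSmooth.ne_zero (hN : 0 < N) (hF : IsSmooth F) : F ≠ 0 := by
  rintro rfl
  have h := hF (fun _ => 1) (by simp)
  exact one_ne_zero (congrFun h ⟨0, hN⟩)

theorem eval_smul_of_isHomogeneous (hFd : F.IsHomogeneous d) (t : ℂ) (x : Fin N → ℂ) :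
    MvPolynomial.eval (t • x) F = t ^ d * MvPolynomial.eval x F := by
  rw [MvPolynomial.eval_eq, MvPolynomial.eval_eq, Finset.mul_sum]
  refine Finset.sum_congr rfl fun μ hμ => ?_
  have hdeg : ∑ i ∈ μ.support, μ i = d := (hFd.degree_eq_sum_deg_support hμ).symm
  simp only [Pi.smul_apply, smul_eq_mul, mul_pow, Finset.prod_mul_distrib,
    Finset.prod_pow_eq_pow_sum, hdeg]
  ring

/-- A multiple factor of `F` divides all partial derivatives of `F`, so that its zeros are
singular points. -/
theorem IsSmooth.squarefree (hN : 2 ≤ N) (hF : IsSmooth F) : Squarefree F := by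
  intro p hp
  by_contra hu
  obtain ⟨x, hx, hpx⟩ := exists_ne_zero_eval_eq_zero (by rw [Fintype.card_fin]; omega) hu
  obtain ⟨q, rfl⟩ := hp
  refine hx (hF x fun i => ?_)
  simp [Derivation.leibniz, hpx]

theorem IsSmooth.exists_eq_C_mul (hN : 2 ≤ N) (hd : d ≠ 0) (hF : IsSmooth F)
    (hFd : F.IsHomogeneous d) {F' : MvPolynomial (Fin N) ℂ} (hFd' : F'.IsHomogeneous d)
    (hF' : F' ≠ 0) (h : ∀ x, MvPolynomial.eval x F = 0 → MvPolynomial.eval x F' = 0) :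
    ∃ c : ℂˣ, F' = c • F := by
  have hF0 := hF.ne_zero (by omega)
  have hmem : F' ∈ MvPolynomial.vanishingIdeal ℂ
      (MvPolynomial.zeroLocus ℂ (Ideal.span {F})) := by
    rw [MvPolynomial.mem_vanishingIdeal_iff]
    intro x hx
    rw [MvPolynomial.zeroLocus_span] at hx
    simpa [MvPolynomial.aeval_eq_eval] using
      h x (by simpa [MvPolynomial.aeval_eq_eval] using hx F rfl)
  rw [MvPolynomial.vanishingIdeal_zeroLocus_eq_radical] at hmem
  obtain ⟨n, hn⟩ := hmem
  rw [Ideal.mem_span_singleton] at hn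
  have hn0 : n ≠ 0 := by
    rintro rfl
    have hu : IsUnit F := isUnit_of_dvd_one (by simpa using hn)
    obtain ⟨x, -, hx⟩ : ∃ x : Fin N → ℂ, x = 0 ∧ MvPolynomial.eval x F = 0 :=
      ⟨0, rfl, by
        simpa [hd] using eval_smul_of_isHomogeneous hFd 0 0⟩
    have := hu.map (MvPolynomial.eval x)
    rw [hx] at this
    exact not_isUnit_zero this
  obtain ⟨p, rfl⟩ := ((hF.squarefree hN).dvd_pow_iff_dvd hn0).1 hn
  have hp : p ≠ 0 := right_ne_zero_of_mul hF'
  have hdeg := MvPolynomial.totalDegree_mul_of_isDomain hF0 hp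
  rw [hFd'.totalDegree hF', hFd.totalDegree hF0] at hdeg
  have hpC := (MvPolynomial.totalDegree_eq_zero_iff_eq_C).1 (show p.totalDegree = 0 by omega)
  have hc : MvPolynomial.coeff 0 p ≠ 0 := fun h0 => hp (by rw [hpC, h0, map_zero])
  refine ⟨Units.mk0 _ hc, ?_⟩
  rw [Units.smul_def, Units.val_mk0, MvPolynomial.smul_eq_C_mul, ← hpC, mul_comm]

/-- The polynomial `F(P x)` for a square matrix `P`. -/
noncomputable def linSubst (P : Matrix (Fin N) (Fin N) ℂ) (F : MvPolynomial (Fin N) ℂ) :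
    MvPolynomial (Fin N) ℂ :=
  MvPolynomial.aeval (fun i => ∑ j, MvPolynomial.C (P i j) * MvPolynomial.X j) F

theorem eval_linSubst (P : Matrix (Fin N) (Fin N) ℂ) (F : MvPolynomial (Fin N) ℂ)
    (x : Fin N → ℂ) :
    MvPolynomial.eval x (linSubst P F) = MvPolynomial.eval (P.mulVec x) F := by
  induction F using MvPolynomial.induction_on with
  | C a => simp [linSubst]
  | add p q hp hq => simp only [linSubst, map_add] at *; rw [hp, hq]
  | mul_X p i hp =>
    simp only [linSubst, map_mul, MvPolynomial.aeval_X] at *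
    rw [hp]
    simp [Matrix.mulVec, dotProduct]

theorem pderiv_linSubst (P : Matrix (Fin N) (Fin N) ℂ) (F : MvPolynomial (Fin N) ℂ)
    (j : Fin N) :
    MvPolynomial.pderiv j (linSubst P F) =
      ∑ i, MvPolynomial.C (P i j) * linSubst P (MvPolynomial.pderiv i F) := by
  induction F using MvPolynomial.induction_on with
  | C a => simp [linSubst]
  | add p q hp hq =>
    simp only [linSubst, map_add, mul_add, Finset.sum_add_distrib] at *
    rw [hp, hq]
  | mul_X p k hp =>
    simp only [linSubst, map_mul, MvPolynomial.aeval_X, Derivation.leibniz, smul_eq_mul, map_add,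
      mul_add, Finset.sum_add_distrib, map_sum, MvPolynomial.pderiv_X, MvPolynomial.pderiv_C,
      mul_zero, add_zero] at *
    rw [hp]
    congr 1
    · rw [Finset.sum_eq_single j, Finset.sum_eq_single k]
      · simp [mul_comm]
      · intro i _ hi
        simp [Ne.symm hi]
      · simp
      · intro i _ hi
        simp [Ne.symm hi]
      · simp
    · rw [Finset.mul_sum]
      exact Finset.sum_congr rfl fun i _ => mul_left_comm _ _ _

theorem isHomogeneous_linSubst (P : Matrix (Fin N) (Fin N) ℂ) (hFd : F.IsHomogeneous d) :
    (linSubst P F).IsHomogeneous d := by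
  have := hFd.aeval (n := 1) (fun i => ∑ j, MvPolynomial.C (P i j) * MvPolynomial.X j)
    fun i => MvPolynomial.IsHomogeneous.sum _ _ _ fun j _ =>
      (MvPolynomial.isHomogeneous_X ℂ j).C_mul (P i j)
  rwa [one_mul] at this

theorem IsSmooth.linSubst (hF : IsSmooth F) (P : GL (Fin N) ℂ) :
    IsSmooth (linSubst (P : Matrix (Fin N) (Fin N) ℂ) F) := by
  intro x hx
  have hP : Function.Injective (P : Matrix (Fin N) (Fin N) ℂ).mulVec :=
    Matrix.mulVec_injective_iff_isUnit.2 P.isUnit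
  have hP' : Function.Injective (P : Matrix (Fin N) (Fin N) ℂ).vecMul :=
    Matrix.vecMul_injective_iff_isUnit.2 P.isUnit
  have h0 : (fun i => MvPolynomial.eval ((P : Matrix (Fin N) (Fin N) ℂ).mulVec x)
      (MvPolynomial.pderiv i F)) = 0 := by
    refine hP' ?_
    funext j
    have := hx j
    rw [pderiv_linSubst, map_sum] at this
    simpa [Matrix.vecMul, dotProduct, eval_linSubst, mul_comm] using this
  have := hF _ fun i => congrFun h0 i
  exact hP (by simpa using this)

theorem linSubst_ne_zero (hF : F ≠ 0) (P : GL (Fin N) ℂ) :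
    linSubst (P : Matrix (Fin N) (Fin N) ℂ) F ≠ 0 := by
  intro h
  refine hF (MvPolynomial.funext fun x => ?_)
  have := eval_linSubst (P : Matrix (Fin N) (Fin N) ℂ) F
    ((P⁻¹ : GL (Fin N) ℂ).val.mulVec x)
  rw [h, Matrix.mulVec_mulVec, ← Units.val_mul, mul_inv_cancel] at this
  simpa using this.symm

/-- A linear automorphism of `V(F)` multiplies the equation `F` by a constant. -/
theorem exists_linSubst_eq_smul (hN : 2 ≤ N) (hd : d ≠ 0) (hF : IsSmooth F)
    (hFd : F.IsHomogeneous d) {g : GL (Fin N) ℂ}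
    (hg : Matrix.ProjGenLinGroup.mk g ∈ linAut F) :
    ∃ c : ℂˣ, linSubst (g : Matrix (Fin N) (Fin N) ℂ) F = c • F := by
  refine hF.exists_eq_C_mul hN hd hFd (isHomogeneous_linSubst _ hFd)
    (linSubst_ne_zero (hF.ne_zero (by omega)) g) fun x hx => ?_
  rw [eval_linSubst]
  rcases eq_or_ne x 0 with rfl | hx0
  · rwa [Matrix.mulVec_zero]
  have hmem : Projectivization.mk ℂ x hx0 ∈ hypersurface F := by
    intro v hv
    rw [Projectivization.submodule_mk, Submodule.mem_span_singleton] at hv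
    obtain ⟨t, rfl⟩ := hv
    rw [eval_smul_of_isHomogeneous hFd, hx, mul_zero]
  have hstab : Matrix.ProjGenLinGroup.mk g • hypersurface F = hypersurface F := hg
  have := Set.smul_mem_smul_set (a := Matrix.ProjGenLinGroup.mk g) hmem
  rw [hstab, Projectivization.PGL.mk_smul_mk] at this
  refine this _ ?_
  rw [Projectivization.submodule_mk]
  exact Submodule.mem_span_singleton_self _

end Smooth

/-! ### Simultaneous diagonalization -/

theorem coe_diagGL (N : ℕ) (t : Fin N → ℂˣ) :
    (diagGL N t : Matrix (Fin N) (Fin N) ℂ) = Matrix.diagonal fun i => (t i : ℂ) := rfl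

theorem rescale_eq_linSubst {N : ℕ} (t : Fin N → ℂˣ) (F : MvPolynomial (Fin N) ℂ) :
    rescale t F = linSubst (diagGL N t : Matrix (Fin N) (Fin N) ℂ) F := by
  rw [rescale, linSubst]
  congr 2
  funext i
  rw [Finset.sum_eq_single i]
  · simp [coe_diagGL]
  · intro j _ hj
    simp [coe_diagGL, Matrix.diagonal_apply_ne _ hj.symm]
  · simp

theorem linSubst_mul {N : ℕ} (P Q : Matrix (Fin N) (Fin N) ℂ) (F : MvPolynomial (Fin N) ℂ) :
    linSubst (P * Q) F = linSubst Q (linSubst P F) :=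
  MvPolynomial.funext fun x => by simp only [eval_linSubst, Matrix.mulVec_mulVec]

theorem linSubst_smul {N : ℕ} (P : Matrix (Fin N) (Fin N) ℂ) (c : ℂˣ)
    (F : MvPolynomial (Fin N) ℂ) : linSubst P (c • F) = c • linSubst P F := by
  simp [linSubst, Units.smul_def]

/-- Vectors on which the finite abelian group `G` acts through a character span: every `v` is
the average of its isotypic components `∑ g, χ(g)⁻¹ g v`. -/
theorem span_eigenvectors_eq_top {G : Type*} [CommGroup G] [Finite G] {N : ℕ}
    (j : G →* GL (Fin N) ℂ) :
    Submodule.span ℂ {v : Fin N → ℂ | ∃ χ : G →* ℂˣ, ∀ g,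
      (j g : Matrix (Fin N) (Fin N) ℂ).mulVec v = (χ g : ℂ) • v} = ⊤ := by
  classical
  have := Fintype.ofFinite G
  have := Fintype.ofFinite (G →* ℂˣ)
  rw [eq_top_iff]
  rintro v -
  -- The component of `v` belonging to the character `χ`.
  let p (χ : G →* ℂˣ) : Fin N → ℂ :=
    ∑ g : G, ((χ g⁻¹ : ℂˣ) : ℂ) • (j g : Matrix (Fin N) (Fin N) ℂ).mulVec v
  have hp (χ : G →* ℂˣ) (h : G) :
      (j h : Matrix (Fin N) (Fin N) ℂ).mulVec (p χ) = (χ h : ℂ) • p χ := by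
    simp only [p, Matrix.mulVec_sum, Finset.smul_sum]
    refine Fintype.sum_equiv (Equiv.mulLeft h) _ _ fun g => ?_
    rw [Matrix.mulVec_smul, Matrix.mulVec_mulVec, ← Units.val_mul, ← map_mul, smul_smul,
      ← Units.val_mul, ← map_mul]
    simp
  have hsum : ∑ χ : G →* ℂˣ, p χ = (Fintype.card (G →* ℂˣ) : ℂ) • v := by
    simp only [p]
    rw [Finset.sum_comm, Finset.sum_eq_single 1]
    · ext i
      simp [Finset.sum_const]
    · intro g _ hg
      rw [← Finset.sum_smul]
      obtain ⟨ψ, hψ⟩ := CommGroup.exists_apply_ne_one_of_hasEnoughRootsOfUnity G ℂ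
        (inv_ne_one.2 hg)
      have hS : ((ψ g⁻¹ : ℂˣ) : ℂ) * ∑ χ : G →* ℂˣ, ((χ g⁻¹ : ℂˣ) : ℂ) =
          ∑ χ : G →* ℂˣ, ((χ g⁻¹ : ℂˣ) : ℂ) := by
        rw [Finset.mul_sum]
        exact Fintype.sum_equiv (Equiv.mulLeft ψ) _ _ fun χ => by simp
      have h0 : ∑ χ : G →* ℂˣ, ((χ g⁻¹ : ℂˣ) : ℂ) = 0 := by
        by_contra hne
        exact hψ (Units.ext (mul_right_cancel₀ hne (by rw [hS, Units.val_one, one_mul])))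
      rw [h0, zero_smul]
    · simp
  have hcard : (Fintype.card (G →* ℂˣ) : ℂ) ≠ 0 := Nat.cast_ne_zero.2 Fintype.card_ne_zero
  rw [← inv_smul_smul₀ hcard v, ← hsum]
  exact Submodule.smul_mem _ _ (Submodule.sum_mem _ fun χ _ =>
    Submodule.subset_span ⟨χ, hp χ⟩)

theorem exists_simultaneous_diagonalization {G : Type*} [CommGroup G] [Finite G] {N : ℕ}
    (j : G →* GL (Fin N) ℂ) :
    ∃ (P : GL (Fin N) ℂ) (w : Fin N → (G →* ℂˣ)), ∀ g,
      j g * P = P * diagGL N fun i => w i g := by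
  let b := Module.Basis.ofSpan (span_eigenvectors_eq_top j).ge
  have hb (i) := Module.Basis.ofSpan_subset (span_eigenvectors_eq_top j).ge ⟨i, rfl⟩
  let e := b.indexEquiv (Pi.basisFun ℂ (Fin N))
  let b' := b.reindex e
  have hb' (i) : ∃ χ : G →* ℂˣ, ∀ g,
      (j g : Matrix (Fin N) (Fin N) ℂ).mulVec (b' i) = (χ g : ℂ) • b' i := by
    rw [Module.Basis.reindex_apply]
    exact hb (e.symm i)
  choose w hw using hb'
  have hunit : IsUnit (Matrix.of fun i k => b' k i) := by
    rw [← Matrix.linearIndependent_cols_iff_isUnit]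
    exact b'.linearIndependent
  refine ⟨hunit.unit, w, fun g => Units.ext ?_⟩
  ext i k
  rw [Units.val_mul, Units.val_mul, coe_diagGL, Matrix.mul_diagonal]
  have := congrFun (hw k g) i
  simpa [Matrix.mul_apply, Matrix.mulVec, dotProduct, mul_comm] using this

theorem coeff_rescale {N : ℕ} (t : Fin N → ℂˣ) (F : MvPolynomial (Fin N) ℂ)
    (μ : Fin N →₀ ℕ) :
    MvPolynomial.coeff μ (rescale t F) = ((∏ i, t i ^ μ i : ℂˣ) : ℂ) * MvPolynomial.coeff μ F := by
  classical
  induction F using MvPolynomial.induction_on' with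
  | monomial u a =>
    have : rescale t (MvPolynomial.monomial u a) =
        MvPolynomial.monomial u (((∏ i, t i ^ u i : ℂˣ) : ℂ) * a) := by
      rw [rescale, MvPolynomial.aeval_monomial, MvPolynomial.algebraMap_eq,
        Finsupp.prod_fintype _ _ (by simp), MvPolynomial.monomial_eq (s := u),
        Finsupp.prod_fintype _ _ (by simp)]
      simp only [mul_pow, Finset.prod_mul_distrib, Units.coe_prod, Units.val_pow_eq_pow_val,
        map_mul, map_prod, map_pow]
      ring
    rw [this, MvPolynomial.coeff_monomial, MvPolynomial.coeff_monomial]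
    split_ifs with h
    · rw [h]
    · simp
  | add p q hp hq =>
    have : rescale t (p + q) = rescale t p + rescale t q := by simp [rescale]
    rw [this, MvPolynomial.coeff_add, hp, hq, MvPolynomial.coeff_add, mul_add]

/-- In a basis of simultaneous eigenvectors, with characters `w i`, the hypersurface has a smooth
equation all of whose monomials have the same weight. -/
theorem exists_weights {N d : ℕ} (hN : 2 ≤ N) (hd : d ≠ 0) {G : Type*} [CommGroup G] [Finite G]
    {F : MvPolynomial (Fin N) ℂ} (hFd : F.IsHomogeneous d) (hF : IsSmooth F)
    (j : G →* GL (Fin N) ℂ) (hj : ∀ g, Matrix.ProjGenLinGroup.mk (j g) ∈ linAut F)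
    (hinj : ∀ g, Matrix.ProjGenLinGroup.mk (j g) = 1 → g = 1) :
    ∃ (F₁ : MvPolynomial (Fin N) ℂ) (w : Fin N → (G →* ℂˣ)) (a : G →* ℂˣ),
      F₁.IsHomogeneous d ∧ IsSmooth F₁ ∧ (∀ μ ∈ F₁.support, ∏ i, w i ^ μ i = a) ∧
      ∀ g (c : ℂˣ), (∀ i, w i g = c) → g = 1 := by
  obtain ⟨P, w, hP⟩ := exists_simultaneous_diagonalization j
  have hsemi (g : G) : ∃ c : ℂˣ, rescale (fun i => w i g)
      (linSubst (P : Matrix (Fin N) (Fin N) ℂ) F) =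
        c • linSubst (P : Matrix (Fin N) (Fin N) ℂ) F := by
    obtain ⟨c, hc⟩ := exists_linSubst_eq_smul hN hd hF hFd (hj g)
    exact ⟨c, by rw [rescale_eq_linSubst, ← linSubst_mul, ← Units.val_mul, ← hP, Units.val_mul,
      linSubst_mul, hc, linSubst_smul]⟩
  have hsm := hF.linSubst P
  obtain ⟨ν, hν⟩ := MvPolynomial.support_nonempty.2 (hsm.ne_zero (by omega))
  have hval (g : G) (c : ℂˣ) (hc : rescale (fun i => w i g)
      (linSubst (P : Matrix (Fin N) (Fin N) ℂ) F) =
        c • linSubst (P : Matrix (Fin N) (Fin N) ℂ) F) (μ)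
      (hμ : μ ∈ (linSubst (P : Matrix (Fin N) (Fin N) ℂ) F).support) :
      ∏ i, w i g ^ μ i = c := by
    have := congrArg (MvPolynomial.coeff μ) hc
    rw [coeff_rescale, Units.smul_def, MvPolynomial.coeff_smul, smul_eq_mul] at this
    exact Units.ext (mul_right_cancel₀ (MvPolynomial.mem_support_iff.1 hμ) this)
  refine ⟨linSubst (P : Matrix (Fin N) (Fin N) ℂ) F, w, ∏ i, w i ^ ν i,
    isHomogeneous_linSubst _ hFd, hsm, fun μ hμ => ?_, fun g c hc => hinj g ?_⟩
  · ext1 g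
    obtain ⟨c, hc⟩ := hsemi g
    simpa using (hval g c hc μ hμ).trans (hval g c hc ν hν).symm
  · have hs : diagGL N (fun i => w i g) = Matrix.GeneralLinearGroup.scalar (Fin N) c := by
      refine Units.ext ?_
      simp only [coe_diagGL, hc]
      rfl
    have h2 : j g * P = Matrix.GeneralLinearGroup.scalar (Fin N) c * P := by
      rw [hP, hs]
      refine Units.ext ?_
      simpa using (Matrix.scalar_commute (c : ℂ) (fun r => Commute.all _ r)
        (P : Matrix (Fin N) (Fin N) ℂ)).eq.symm
    rw [mul_right_cancel h2, Matrix.ProjGenLinGroup.mk_scalar]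

/-! ### Smoothness and weights -/

/-- If a polynomial of weight `a` contains the monomial `x_i ^ n * x_j`, then the weight of `x_j`
is obtained from that of `x_i` by this map. It is affine, with linear part `x ↦ x ^ (-n)`. -/
def weightStep {A : Type*} [CommGroup A] (a : A) (n : ℕ) (x : A) : A := a / x ^ n

/-- Smoothness forces the weights to be spread out: with respect to any subgroup `K`, the
weights in the coset of `a - (d - 1) v` are at least as many as those in the coset of `v`.
Indeed, on the coordinate subspace of the variables with weight in `v + K`, only the partial
derivatives in the directions with weight in `a - (d - 1) v + K` can be nonzero; were they fewer
than the dimension of the subspace, they would have a common zero there. -/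
theorem IsSmooth.card_weights_le {N d : ℕ} (hd : 2 ≤ d) {F : MvPolynomial (Fin N) ℂ}
    (hFd : F.IsHomogeneous d) (hF : IsSmooth F) {A : Type*} [CommGroup A] (w : Fin N → A)
    (a : A) (hw : ∀ μ ∈ F.support, ∏ i, w i ^ μ i = a) (K : Subgroup A) (v : A) :
    Nat.card {i // w i / v ∈ K} ≤ Nat.card {i // w i / weightStep a (d - 1) v ∈ K} := by
  classical
  by_contra! hlt
  rw [Nat.card_eq_fintype_card, Nat.card_eq_fintype_card] at hlt
  let S := {i // w i / v ∈ K}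
  let J := {i // w i / weightStep a (d - 1) v ∈ K}
  let R : MvPolynomial (Fin N) ℂ →ₐ[ℂ] MvPolynomial S ℂ :=
    MvPolynomial.aeval fun i => if h : w i / v ∈ K then MvPolynomial.X ⟨i, h⟩ else 0
  let y (x : S → ℂ) (i : Fin N) : ℂ := if h : w i / v ∈ K then x ⟨i, h⟩ else 0
  have hR (x : S → ℂ) (p : MvPolynomial (Fin N) ℂ) :
      MvPolynomial.eval x (R p) = MvPolynomial.eval (y x) p := by
    have : ((MvPolynomial.aeval x).comp R : MvPolynomial (Fin N) ℂ →ₐ[ℂ] ℂ) =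
        MvPolynomial.aeval (y x) := by
      refine MvPolynomial.algHom_ext fun i => ?_
      by_cases h : w i / v ∈ K <;> simp [R, y, h]
    simpa [MvPolynomial.aeval_eq_eval] using DFunLike.congr_fun this p
  let s : Finset (MvPolynomial S ℂ) :=
    Finset.univ.image fun k : J => R (MvPolynomial.pderiv (k : Fin N) F)
  obtain ⟨x, hx, hs⟩ := exists_ne_zero_forall_eval_eq_zero s
    (lt_of_le_of_lt Finset.card_image_le hlt) (by
      intro f hf
      obtain ⟨k, -, rfl⟩ := Finset.mem_image.1 hf
      have hy : y 0 = 0 := by funext i; simp [y]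
      rw [hR, hy]
      simpa [show d - 1 ≠ 0 by omega] using
        eval_smul_of_isHomogeneous (hFd.pderiv (i := (k : Fin N))) 0 0)
  have hyx : y x = 0 := by
    refine hF _ fun k => ?_
    by_cases hk : w k / weightStep a (d - 1) v ∈ K
    · rw [← hR]
      exact hs _ (Finset.mem_image.2 ⟨⟨k, hk⟩, Finset.mem_univ _, rfl⟩)
    · rw [MvPolynomial.eval_eq]
      refine Finset.sum_eq_zero fun μ hμ => ?_
      by_cases hμS : ∃ i ∈ μ.support, w i / v ∉ K
      · obtain ⟨i, hi, hiv⟩ := hμS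
        rw [Finset.prod_eq_zero hi, mul_zero]
        simp [y, hiv, Finsupp.mem_support_iff.1 hi]
      · push Not at hμS
        exfalso
        have hμF : μ + Finsupp.single k 1 ∈ F.support := by
          rw [MvPolynomial.mem_support_iff, MvPolynomial.coeff_pderiv] at hμ
          exact MvPolynomial.mem_support_iff.2 fun h0 => hμ (by rw [h0]; simp)
        have h1 : (∏ i, w i ^ μ i) * w k = a := by
          rw [← hw _ hμF]
          simp only [Finsupp.add_apply, pow_add, Finset.prod_mul_distrib]
          congr 1
          rw [Finset.prod_eq_single k]
          · simp
          · intro i _ hi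
            simp [Finsupp.single_eq_of_ne hi]
          · simp
        have h2 : ∑ i, μ i = d - 1 := by
          have := (hFd.pderiv (i := k)).degree_eq_sum_deg_support hμ
          rw [this]
          exact (Finset.sum_subset (Finset.subset_univ _) (by simp)).symm
        have h3 : ∏ i, (w i / v) ^ μ i ∈ K := by
          refine K.prod_mem fun i _ => ?_
          by_cases hi : i ∈ μ.support
          · exact K.pow_mem (hμS i hi) _
          · rw [Finsupp.notMem_support_iff.1 hi, pow_zero]
            exact K.one_mem
        refine hk ?_
        have h4 : w k / weightStep a (d - 1) v = (∏ i, (w i / v) ^ μ i)⁻¹ := by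
          simp only [weightStep, div_pow, Finset.prod_div_distrib, Finset.prod_pow_eq_pow_sum, h2,
            ← h1, inv_div]
          rw [div_div_eq_mul_div, mul_comm (w k), mul_div_mul_right_eq_div]
        rw [h4]
        exact K.inv_mem h3
  refine hx (funext fun i => ?_)
  have := congrFun hyx i
  simpa [y, i.2] using this

/-! ### Dynamics of the weights -/

section Dynamics

variable {A : Type*} [CommGroup A] (a : A) (n : ℕ)

theorem iterate_weightStep_div (k : ℕ) (x y : A) :
    (weightStep a n)^[k] x / (weightStep a n)^[k] y = (x / y) ^ ((-(n : ℤ)) ^ k) := by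
  induction k with
  | zero => simp
  | succ k ih =>
    rw [Function.iterate_succ_apply', Function.iterate_succ_apply', weightStep, weightStep,
      div_div_div_cancel_left, ← div_pow, ← inv_div, ih, pow_succ, zpow_mul, zpow_neg, zpow_natCast,
      inv_pow]

/-- On a finite set, some iterate of a self-map is idempotent. -/
theorem exists_iterate_idempotent {α : Type*} [Finite α] (f : α → α) :
    ∃ L, 0 < L ∧ ∀ x, f^[L] (f^[L] x) = f^[L] x := by
  obtain ⟨i, j, hij, h⟩ : ∃ i j : ℕ, i < j ∧ f^[i] = f^[j] := by
    obtain ⟨i, j, hne, h⟩ := Finite.exists_ne_map_eq_of_infinite fun k : ℕ => f^[k]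
    rcases hne.lt_or_gt with hlt | hlt
    exacts [⟨i, j, hlt, h⟩, ⟨j, i, hlt, h.symm⟩]
  have hstep (s k : ℕ) (hs : i ≤ s) : f^[s + k * (j - i)] = f^[s] := by
    induction k with
    | zero => simp
    | succ k ih =>
      have e1 : s + (k + 1) * (j - i) = (s + k * (j - i) - i) + j := by
        have : (k + 1) * (j - i) = k * (j - i) + (j - i) := by ring
        omega
      rw [e1, Function.iterate_add, ← h, ← Function.iterate_add, ← ih]
      congr 1
      omega
  have hpos : 0 < j - i := by omega
  refine ⟨(i + 1) * (j - i), Nat.mul_pos i.succ_pos hpos, fun x => ?_⟩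
  rw [← Function.iterate_add_apply, hstep _ _ (by nlinarith)]

/-- The subgroup of elements killed by the `r`-th iterate of the linear part of `weightStep`. -/
def depthSubgroup (A : Type*) [CommGroup A] (n r : ℕ) : Subgroup A :=
  (zpowGroupHom ((-(n : ℤ)) ^ r)).ker

theorem mem_depthSubgroup {r : ℕ} {x : A} :
    x ∈ depthSubgroup A n r ↔ x ^ ((-(n : ℤ)) ^ r) = 1 := by
  rw [depthSubgroup, MonoidHom.mem_ker, zpowGroupHom_apply]

theorem depthSubgroup_mono {r s : ℕ} (h : r ≤ s) : depthSubgroup A n r ≤ depthSubgroup A n s := by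
  intro x hx
  rw [mem_depthSubgroup] at hx ⊢
  obtain ⟨k, rfl⟩ := Nat.exists_eq_add_of_le h
  rw [pow_add, zpow_mul, hx, one_zpow]

theorem map_mem_depthSubgroup {B : Type*} [CommGroup B] (f : A →* B) {r : ℕ} {x : A}
    (hx : x ∈ depthSubgroup A n r) : f x ∈ depthSubgroup B n r := by
  rw [mem_depthSubgroup] at hx ⊢
  rw [← map_zpow, hx, map_one]

variable {a n}

theorem iterate_weightStep_mul_of_fixed {c β : A} {m : ℕ} (hc : weightStep a n c = c)
    (hβ : β ∈ depthSubgroup A n m) : (weightStep a n)^[m] (c * β) = c := by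
  have h := iterate_weightStep_div a n m (c * β) c
  rwa [Function.iterate_fixed hc, mul_div_cancel_left, (mem_depthSubgroup n).1 hβ,
    div_eq_one] at h

/-- Each weight `w i` is attracted by a periodic point `z i` of `weightStep`, from which it differs
by an element of `depthSubgroup A n m`. If `m` is the least possible, then the spreading condition
`hw` makes every level of depth at most `m` nonempty above each point of the orbit of some
`z i`, so that this orbit has many weights attracted to it. -/
theorem exists_periodic_limits [Finite A] {N : ℕ} (w : Fin N → A)
    (hw : ∀ (K : Subgroup A) (v : A),
      Nat.card {i // w i / v ∈ K} ≤ Nat.card {i // w i / weightStep a n v ∈ K}) :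
    ∃ (z : Fin N → A) (m : ℕ),
      (∀ i, z i ∈ Function.periodicPts (weightStep a n)) ∧
      (∀ i, weightStep a n (z i) ∈ Set.range z) ∧
      (∀ i, w i / z i ∈ depthSubgroup A n m) ∧
      (m ≠ 0 → ∃ i, (Set.range z).ncard + m ≤ N ∧
        (weightStep a n (z i) ≠ z i → (Set.range z).ncard + 2 * m ≤ N)) := by
  classical
  set T := weightStep a n with hT
  obtain ⟨L, hL, hidem⟩ := exists_iterate_idempotent T
  have hstep (i : Fin N) : ∃ j, w j = T (w i) := by
    have h1 := hw ⊥ (w i)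
    have : Nonempty {k // w k / w i ∈ (⊥ : Subgroup A)} := ⟨⟨i, by simp⟩⟩
    have h2 : 0 < Nat.card {j // w j / T (w i) ∈ (⊥ : Subgroup A)} := Nat.card_pos.trans_le h1
    obtain ⟨⟨j, hj⟩⟩ := (Nat.card_pos_iff.1 h2).1
    exact ⟨j, div_eq_one.1 (Subgroup.mem_bot.1 hj)⟩
  have hiter (i : Fin N) (k : ℕ) : ∃ j, w j = T^[k] (w i) := by
    induction k with
    | zero => exact ⟨i, rfl⟩
    | succ k ih =>
      obtain ⟨j, hj⟩ := ih
      obtain ⟨l, hl⟩ := hstep j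
      exact ⟨l, by rw [hl, hj, Function.iterate_succ_apply']⟩
  have hdepth : ∃ m, ∀ i, w i / T^[L] (w i) ∈ depthSubgroup A n m := by
    refine ⟨L, fun i => ?_⟩
    rw [mem_depthSubgroup, ← iterate_weightStep_div a, ← hT, hidem, div_self']
  refine ⟨fun i => T^[L] (w i), Nat.find hdepth, fun i => ⟨L, hL, hidem (w i)⟩, fun i => ?_,
    Nat.find_spec hdepth, fun hm => ?_⟩
  · obtain ⟨j, hj⟩ := hstep i
    refine ⟨j, ?_⟩
    change T^[L] (w j) = T (T^[L] (w i))
    rw [hj, ← Function.iterate_succ_apply, Function.iterate_succ_apply']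
  set m := Nat.find hdepth with hmdef
  have hmL : m ≤ L := Nat.find_min' hdepth fun i => by
    rw [mem_depthSubgroup, ← iterate_weightStep_div a, ← hT, hidem, div_self']
  obtain ⟨i, hi⟩ : ∃ i, w i / T^[L] (w i) ∉ depthSubgroup A n (m - 1) := by
    have := Nat.find_min hdepth (show m - 1 < Nat.find hdepth by omega)
    push Not at this
    exact this
  have him := Nat.find_spec hdepth i
  -- The number of variables whose weight has depth at most `r` above `v`.
  let c (r : ℕ) (v : A) : ℕ := Nat.card {j // w j / v ∈ depthSubgroup A n r}
  have hc_iter (r k : ℕ) (v : A) : c r v ≤ c r (T^[k] v) := by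
    induction k with
    | zero => exact le_rfl
    | succ k ih => rw [Function.iterate_succ_apply']; exact ih.trans (hw _ _)
  have hc_eq (r k : ℕ) (v : A) (hv : T^[L] v = v) : c r (T^[k] v) = c r v := by
    refine le_antisymm ?_ (hc_iter r k v)
    have hk : T^[k * L] v = v := (show Function.IsPeriodicPt T L v from hv).const_mul k
    have hle : k ≤ k * L := Nat.le_mul_of_pos_right k hL
    calc c r (T^[k] v) ≤ c r (T^[k * L - k] (T^[k] v)) := hc_iter _ _ _
      _ = c r v := by rw [← Function.iterate_add_apply, Nat.sub_add_cancel hle, hk]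
  set v := T^[L] (w i) with hv
  have hvL : T^[L] v = v := hidem (w i)
  -- Some iterate of `w i` has depth exactly `r + 1`, and the counts are constant along the orbit.
  have hc_succ (r : ℕ) (hr : r < m) : c r v < c (r + 1) v := by
    rw [← hc_eq r (m - 1 - r) v hvL, ← hc_eq (r + 1) (m - 1 - r) v hvL]
    obtain ⟨j, hj⟩ := hiter i (m - 1 - r)
    have hmem (s : ℕ) : w j / T^[m - 1 - r] v ∈ depthSubgroup A n s ↔
        w i / v ∈ depthSubgroup A n (m - 1 - r + s) := by
      rw [mem_depthSubgroup, mem_depthSubgroup, hj, hT, iterate_weightStep_div, ← zpow_mul,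
        ← pow_add]
    have h1 := (hmem (r + 1)).2 (by rwa [show m - 1 - r + (r + 1) = m by omega])
    have h2 := mt (hmem r).1 (by rwa [show m - 1 - r + r = m - 1 by omega])
    refine Set.ncard_lt_ncard (s := {j | w j / T^[m - 1 - r] v ∈ depthSubgroup A n r})
      (t := {j | w j / T^[m - 1 - r] v ∈ depthSubgroup A n (r + 1)}) ?_
    exact ⟨fun k hk => depthSubgroup_mono n r.le_succ hk, fun hsub => h2 (hsub h1)⟩
  have hc_ge (r : ℕ) (hr : r ≤ m) : r + 1 ≤ c r v := by
    induction r with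
    | zero =>
      obtain ⟨j, hj⟩ := hiter i L
      have : Nonempty {j // w j / v ∈ depthSubgroup A n 0} :=
        ⟨⟨j, by rw [hj, hv, div_self']; exact one_mem _⟩⟩
      exact Nat.card_pos
    | succ r ih => exact (Nat.succ_le_succ (ih (by omega))).trans (hc_succ r (by omega))
  have hfiber (u : A) (hu : T^[L] u = u) (huc : m + 1 ≤ c m u) :
      m + 1 ≤ (Finset.univ.filter fun j => T^[L] (w j) = u).card := by
    refine huc.trans ?_
    simp only [c]
    rw [Nat.card_eq_fintype_card, Fintype.card_subtype]
    refine Finset.card_le_card fun j hj => ?_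
    simp only [Finset.mem_filter, Finset.mem_univ, true_and] at hj ⊢
    have := depthSubgroup_mono n hmL hj
    rwa [mem_depthSubgroup, ← iterate_weightStep_div a, ← hT, hu, div_eq_one] at this
  have hZ : (Set.range fun i => T^[L] (w i)).ncard =
      (Finset.univ.image fun i => T^[L] (w i)).card := by
    rw [← Set.ncard_coe_finset, Finset.coe_image, Finset.coe_univ, Set.image_univ]
  have hN : N = ∑ u ∈ Finset.univ.image (fun i => T^[L] (w i)),
      (Finset.univ.filter fun j => T^[L] (w j) = u).card := by
    rw [← Finset.card_eq_sum_card_image, Finset.card_univ, Fintype.card_fin]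
  have hpos (u : A) (hu : u ∈ Finset.univ.image fun i => T^[L] (w i)) :
      1 ≤ (Finset.univ.filter fun j => T^[L] (w j) = u).card := by
    obtain ⟨j, -, hj⟩ := Finset.mem_image.1 hu
    exact Finset.card_pos.2 ⟨j, by simpa using hj⟩
  have hvmem : v ∈ Finset.univ.image fun i => T^[L] (w i) :=
    Finset.mem_image.2 ⟨i, Finset.mem_univ _, rfl⟩
  have hTvL : T^[L] (T v) = T v := by
    rw [← Function.iterate_succ_apply, Function.iterate_succ_apply', hvL]
  have hTvmem : T v ∈ Finset.univ.image fun i => T^[L] (w i) := by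
    obtain ⟨j, hj⟩ := hiter i (L + 1)
    refine Finset.mem_image.2 ⟨j, Finset.mem_univ _, ?_⟩
    rw [hj, Function.iterate_succ_apply', ← hv, hTvL]
  have hv1 := hfiber v hvL (hc_ge m le_rfl)
  have hv2 := hfiber (T v) hTvL ((hc_ge m le_rfl).trans (hc_iter m 1 v))
  refine ⟨i, ?_, fun hne => ?_⟩
  · rw [hZ]
    refine le_of_le_of_eq ?_ hN.symm
    rw [← Finset.add_sum_erase _ _ hvmem, ← Finset.card_erase_add_one hvmem]
    have := Finset.card_nsmul_le_sum ((Finset.univ.image fun i => T^[L] (w i)).erase v)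
      (fun u => (Finset.univ.filter fun j => T^[L] (w j) = u).card) 1
      fun u hu => hpos u (Finset.mem_of_mem_erase hu)
    rw [smul_eq_mul, mul_one] at this
    omega
  · replace hne : T v ≠ v := hne
    rw [hZ]
    refine le_of_le_of_eq ?_ hN.symm
    have hTv' := Finset.mem_erase.2 ⟨hne, hTvmem⟩
    rw [← Finset.add_sum_erase _ _ hvmem, ← Finset.card_erase_add_one hvmem,
      ← Finset.add_sum_erase _ _ hTv', ← Finset.card_erase_add_one hTv']
    have := Finset.card_nsmul_le_sum
      (((Finset.univ.image fun i => T^[L] (w i)).erase v).erase (T v))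
      (fun u => (Finset.univ.filter fun j => T^[L] (w j) = u).card) 1
      fun u hu => hpos u (Finset.mem_of_mem_erase (Finset.mem_of_mem_erase hu))
    rw [smul_eq_mul, mul_one] at this
    omega

end Dynamics

/-! ### Simple polynomials with prescribed weights -/

/-- The successor of an index on a chain of length `k`; the last index is its own successor. -/
def chainNext (k : ℕ) (i : Fin k) : Fin k :=
  if h : (i : ℕ) + 1 < k then ⟨i + 1, h⟩ else i

theorem val_chainNext_of_lt {k : ℕ} {i : Fin k} (h : (i : ℕ) + 1 < k) :
    (chainNext k i : ℕ) = i + 1 := by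
  rw [chainNext, dif_pos h]

theorem chainNext_of_not_lt {k : ℕ} {i : Fin k} (h : ¬ (i : ℕ) + 1 < k) : chainNext k i = i :=
  dif_neg h

theorem polyT_eq_sum {d : ℕ} (hd : 1 ≤ d) (k : ℕ) :
    polyT d k = ∑ i, MvPolynomial.X i ^ (d - 1) * MvPolynomial.X (chainNext k i) := by
  refine Finset.sum_congr rfl fun i _ => ?_
  by_cases h : (i : ℕ) + 1 < k
  · rw [dif_pos h, chainNext, dif_pos h]
  · rw [dif_neg h, chainNext_of_not_lt h, ← pow_succ, Nat.sub_add_cancel hd]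

/-- The variable that occurs together with the `(d - 1)`-st power of a given variable in a
polynomial of type `K_k` or `T_k`; for the last variable of `T_k` it is this variable itself. -/
def ComponentType.next : (c : ComponentType) → Fin c.size → Fin c.size
  | K k => finRotate k
  | T k => chainNext k

theorem ComponentType.poly_eq_sum {d : ℕ} (hd : 1 ≤ d) (c : ComponentType) :
    c.poly d = ∑ i, MvPolynomial.X i ^ (d - 1) * MvPolynomial.X (c.next i) := by
  cases c with
  | K k => rfl
  | T k => exact polyT_eq_sum hd k

theorem mk_diagGL_eq_one {N : ℕ} {t : Fin N → ℂˣ}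
    (h : Matrix.ProjGenLinGroup.mk (diagGL N t) = 1) : ∃ c : ℂˣ, ∀ i, t i = c := by
  rw [Matrix.ProjGenLinGroup.mk_eq_one, Matrix.GeneralLinearGroup.center_eq_range_scalar] at h
  obtain ⟨c, hc⟩ := h
  refine ⟨c, fun i => Units.ext ?_⟩
  have h1 : (diagGL N t : Matrix (Fin N) (Fin N) ℂ) i i =
      (Matrix.GeneralLinearGroup.scalar (Fin N) c : Matrix (Fin N) (Fin N) ℂ) i i := by rw [hc]
  rw [coe_diagGL, Matrix.diagonal_apply_eq] at h1
  rw [h1]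
  simp

/-- A simple polynomial whose variables are given the characters `ψ` of `Γ` as weights, all its
monomials having the same weight `a`, is semi-invariant under `Γ`. If only the trivial element of
`Γ` acts by a scalar, then `Γ` embeds in the group of diagonal automorphisms. -/
theorem exists_simple_of_characters {d : ℕ} (hd : 1 ≤ d) {Γ : Type*} [CommGroup Γ] {ι : Type*}
    [Fintype ι] (τ : ι → ComponentType) (ψ : (Σ i, Fin (τ i).size) → (Γ →* ℂˣ)) (a : Γ →* ℂˣ)
    (h : ∀ i x, ψ ⟨i, x⟩ ^ (d - 1) * ψ ⟨i, (τ i).next x⟩ = a)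
    (hinj : ∀ g (c : ℂˣ), (∀ p, ψ p g = c) → g = 1) {n : ℕ}
    (hn : Fintype.card (Σ i, Fin (τ i).size) = n) :
    ∃ (F₀ : MvPolynomial (Fin n) ℂ) (s : ℕ) (τ' : Fin s → ComponentType),
      IsSimpleOfType d τ' F₀ ∧ numTGeTwo τ' = {i | (τ i).IsTGeTwo}.ncard ∧
      ∃ φ : Γ →* diagAut F₀, Function.Injective φ := by
  let e₀ : Fin (Fintype.card ι) ≃ ι := (Fintype.equivFin ι).symm
  let e₁ : (Σ i, Fin (τ (e₀ i)).size) ≃ Σ i, Fin (τ i).size :=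
    Equiv.sigmaCongrLeft (β := fun i => Fin (τ i).size) e₀
  let e : (Σ i, Fin (τ (e₀ i)).size) ≃ Fin n := e₁.trans (Fintype.equivFinOfCardEq hn)
  let F₀ : MvPolynomial (Fin n) ℂ :=
    ∑ i, MvPolynomial.rename (fun x => e ⟨i, x⟩) ((τ (e₀ i)).poly d)
  let t : Γ →* (Fin n → ℂˣ) := MonoidHom.pi fun v => ψ (e₁ (e.symm v))
  have ht (g : Γ) (i) (x) : t g (e ⟨i, x⟩) = ψ ⟨e₀ i, x⟩ g := by
    simp only [t]
    rw [MonoidHom.pi_apply, Equiv.symm_apply_apply]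
    rfl
  have hmem (g : Γ) : t g ∈ diagSemiInvariance F₀ := by
    refine ⟨a g, ?_⟩
    simp only [F₀, rescale, map_sum, Finset.smul_sum]
    refine Finset.sum_congr rfl fun i _ => ?_
    rw [ComponentType.poly_eq_sum hd]
    simp only [map_sum, Finset.smul_sum]
    refine Finset.sum_congr rfl fun x _ => ?_
    simp only [map_mul, map_pow, MvPolynomial.rename_X, MvPolynomial.aeval_X, ht]
    rw [Units.smul_def, MvPolynomial.smul_eq_C_mul, ← h (e₀ i) x]
    simp only [MonoidHom.mul_apply, MonoidHom.pow_apply, Units.val_mul, Units.val_pow_eq_pow_val,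
      map_mul, map_pow]
    ring
  refine ⟨F₀, _, fun i => τ (e₀ i), ⟨e, rfl⟩, ?_, ?_⟩
  · exact Set.ncard_congr' (e₀.subtypeEquiv fun _ => Iff.rfl)
  · refine ⟨((Matrix.ProjGenLinGroup.mk.comp (diagGL n)).comp t).codRestrict (diagAut F₀)
      fun g => Subgroup.mem_map_of_mem _ (hmem g), ?_⟩
    rw [injective_iff_map_eq_one]
    intro g hg
    obtain ⟨c, hc⟩ := mk_diagGL_eq_one (congrArg Subtype.val hg)
    refine hinj g c fun p => ?_
    have := hc (e (e₁.symm p))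
    simp only [t] at this
    rwa [MonoidHom.pi_apply, Equiv.symm_apply_apply, Equiv.apply_symm_apply] at this

/-- A permutation of a finite type splits the type into cycles. -/
theorem exists_cycles.{u} {α : Type u} [Finite α] (f : Equiv.Perm α) :
    ∃ (ι : Type u) (_ : Fintype ι) (k : ι → ℕ+) (e : (Σ i, Fin (k i)) ≃ α),
      ∀ i x, f (e ⟨i, x⟩) = e ⟨i, finRotate _ x⟩ := by
  classical
  let ι := Quotient (Equiv.Perm.SameCycle.setoid f)
  have hperiodic (x : α) : 0 < Function.minimalPeriod f x :=
    Function.minimalPeriod_pos_of_mem_periodicPts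
      (f.injective.mem_periodicPts x)
  let k (q : ι) : ℕ+ := ⟨Function.minimalPeriod f q.out, hperiodic _⟩
  let E (p : Σ i, Fin (k i)) : α := f^[p.2] p.1.out
  have hE : Function.Bijective E := by
    refine ⟨?_, fun y => ?_⟩
    · rintro ⟨q, x⟩ ⟨q', x'⟩ hqq
      have hcyc : f.SameCycle q.out q'.out := by
        have h1 : f.SameCycle q.out (f^[x] q.out) := ⟨(x : ℕ), by
          rw [zpow_natCast, Equiv.Perm.iterate_eq_pow]⟩
        have h2 : f.SameCycle q'.out (f^[x'] q'.out) := ⟨(x' : ℕ), by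
          rw [zpow_natCast, Equiv.Perm.iterate_eq_pow]⟩
        exact h1.trans ((show f^[x] q.out = f^[x'] q'.out from hqq) ▸ h2.symm)
      obtain rfl : q = q' := by
        rw [← Quotient.out_eq q, ← Quotient.out_eq q']
        exact Quotient.sound hcyc
      have := (Function.iterate_eq_iterate_iff_of_lt_minimalPeriod x.2 x'.2).1 hqq
      rw [Fin.ext this]
    · obtain ⟨i, hi⟩ : ∃ i : ℕ, (f ^ i) (Quotient.mk (Equiv.Perm.SameCycle.setoid f) y).out = y :=
        (show f.SameCycle _ _ from
          Quotient.mk_out (s := Equiv.Perm.SameCycle.setoid f) y).exists_nat_pow_eq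
      refine ⟨⟨Quotient.mk _ y, ⟨i % Function.minimalPeriod f _, Nat.mod_lt _ (hperiodic _)⟩⟩, ?_⟩
      simp only [E]
      rw [Function.iterate_mod_minimalPeriod_eq, Equiv.Perm.iterate_eq_pow, hi]
  refine ⟨ι, Fintype.ofFinite ι, k, Equiv.ofBijective E hE, fun i x => ?_⟩
  simp only [Equiv.ofBijective_apply, E]
  rw [← Function.iterate_succ_apply' f, finRotate_apply, ← Function.iterate_mod_minimalPeriod_eq]
  congr 1
  change ((x : ℕ) + 1) % (k i : ℕ) = _
  rw [Fin.val_add, Fin.val_one', Nat.add_mod_mod]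

/-- The cycles of `weightStep` on a finite invariant set `Z` of characters give components of type
`K`, and a chain of characters that ends at a fixed point gives a component of type `T`, here
repeated `t` times. -/
theorem exists_simple_of_invariant_set {d : ℕ} (hd : 1 ≤ d) {Γ : Type*} [CommGroup Γ]
    (a : Γ →* ℂˣ) (Z : Set (Γ →* ℂˣ)) (hZ : Z.Finite)
    (hTZ : Set.BijOn (weightStep a (d - 1)) Z Z) (t m : ℕ) (hm : 1 ≤ m) (b : Γ →* ℂˣ)
    (hb : t ≠ 0 → weightStep a (d - 1) ((weightStep a (d - 1))^[m] b) = (weightStep a (d - 1))^[m] b)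
    (hinj : ∀ g (c : ℂˣ), (∀ z ∈ Z, z g = c) →
      (t ≠ 0 → ∀ r ≤ m, (weightStep a (d - 1))^[r] b g = c) → g = 1) :
    ∃ (F₀ : MvPolynomial (Fin (Z.ncard + t * (m + 1))) ℂ) (s : ℕ) (τ : Fin s → ComponentType),
      IsSimpleOfType d τ F₀ ∧ numTGeTwo τ = t ∧ ∃ φ : Γ →* diagAut F₀, Function.Injective φ := by
  classical
  have := hZ.to_subtype
  have := Fintype.ofFinite Z
  obtain ⟨ι, _, k, e, he⟩ := exists_cycles (Equiv.ofBijective _ hTZ.bijective)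
  let τ : ι ⊕ Fin t → ComponentType :=
    Sum.elim (fun i => .K (k i)) fun _ => .T ⟨m + 1, m.succ_pos⟩
  let ψ (p : Σ i, Fin (τ i).size) : Γ →* ℂˣ :=
    Sum.rec (motive := fun i => Fin (τ i).size → (Γ →* ℂˣ)) (fun i x => (e ⟨i, x⟩ : Γ →* ℂˣ))
      (fun _ x => (weightStep a (d - 1))^[x] b) p.1 p.2
  have hstep (x : Γ →* ℂˣ) : x ^ (d - 1) * weightStep a (d - 1) x = a := mul_div_cancel _ _
  refine (exists_simple_of_characters hd τ ψ a ?_ ?_ ?_).imp fun F₀ => Exists.imp fun s =>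
    Exists.imp fun τ' ⟨h1, h2, h3⟩ => ⟨h1, h2.trans ?_, h3⟩
  · rintro (i | i) x
    · have hx : weightStep a (d - 1) (e ⟨i, x⟩ : Γ →* ℂˣ) = e ⟨i, finRotate _ x⟩ :=
        congrArg Subtype.val (he i x)
      change (e ⟨i, x⟩ : Γ →* ℂˣ) ^ (d - 1) * (e ⟨i, finRotate _ x⟩ : Γ →* ℂˣ) = a
      rw [← hx, hstep]
    · change Fin (m + 1) at x
      have hnext : ψ ⟨.inr i, (τ (.inr i)).next x⟩ =
          weightStep a (d - 1) ((weightStep a (d - 1))^[x] b) := by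
        change (weightStep a (d - 1))^[(chainNext (m + 1) x : ℕ)] b = _
        by_cases hx : (x : ℕ) + 1 < m + 1
        · rw [val_chainNext_of_lt hx, Function.iterate_succ_apply']
        · have hxm : (x : ℕ) = m := by have := x.2; omega
          rw [chainNext_of_not_lt hx, hxm, hb (Nat.ne_zero_of_lt i.2)]
      rw [hnext]
      exact hstep _
  · intro g c hg
    refine hinj g c (fun z hz => ?_) fun ht r hr => ?_
    · have := hg ⟨.inl (e.symm ⟨z, hz⟩).1, (e.symm ⟨z, hz⟩).2⟩
      change (e (e.symm ⟨z, hz⟩) : Γ →* ℂˣ) g = c at this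
      rwa [Equiv.apply_symm_apply] at this
    · exact hg ⟨.inr ⟨0, Nat.pos_of_ne_zero ht⟩, ⟨r, Nat.lt_succ_of_le hr⟩⟩
  · have hcard := Fintype.card_congr e
    rw [Fintype.card_sigma] at hcard
    simp only [Fintype.card_fin] at hcard
    rw [Fintype.card_sigma]
    simp only [Fintype.card_fin]
    rw [Fintype.sum_sum_type]
    change ∑ i, (k i : ℕ) + ∑ _ : Fin t, (m + 1) = _
    rw [hcard, ← Nat.card_eq_fintype_card, Nat.card_coe_set_eq, Finset.sum_const,
      Finset.card_univ, Fintype.card_fin, smul_eq_mul]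
  · have : {i | (τ i).IsTGeTwo} = Set.range (Sum.inr : Fin t → ι ⊕ Fin t) := by
      ext (i | i)
      · simp [τ, ComponentType.IsTGeTwo]
      · simp [τ, ComponentType.IsTGeTwo, hm]
    rw [this, ← Set.image_univ, Set.ncard_image_of_injective _ Sum.inr_injective, Set.ncard_univ,
      Nat.card_eq_fintype_card, Fintype.card_fin]

/-! ### Finite abelian groups and their characters -/

/-- A finite abelian group is non-canonically isomorphic to its dual, so that its quotients are
isomorphic to subgroups. -/
theorem exists_injective_of_surjective {G Γ : Type*} [CommGroup G] [CommGroup Γ] [Finite G]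
    [Finite Γ] (f : Γ →* G) (hf : Function.Surjective f) :
    ∃ φ : G →* Γ, Function.Injective φ := by
  obtain ⟨e⟩ := CommGroup.monoidHom_mulEquiv_of_hasEnoughRootsOfUnity G ℂ
  obtain ⟨e'⟩ := CommGroup.monoidHom_mulEquiv_of_hasEnoughRootsOfUnity Γ ℂ
  let f' : (G →* ℂˣ) →* (Γ →* ℂˣ) := MonoidHom.compHom' f
  have hf' : Function.Injective f' := fun x y hxy => (MonoidHom.cancel_right hf).1 hxy
  exact ⟨(e'.toMonoidHom.comp f').comp e.symm.toMonoidHom,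
    e'.injective.comp (hf'.comp e.symm.injective)⟩

/-- If `G = G₁ × G₂` with `G₁` cyclic and `|G₂|` prime to `n`, then characters killed by a power
of `n` form a cyclic group: under an isomorphism of `G` with its dual they correspond to elements
of `G₁`. -/
theorem isCyclic_of_le_depthSubgroup {G : Type*} [CommGroup G] [Finite G] {G₁ G₂ : Subgroup G}
    (hG : IsCompl G₁ G₂) (hG₁ : IsCyclic G₁) {n m : ℕ} (hG₂ : (Nat.card G₂).Coprime n)
    {B : Subgroup (G →* ℂˣ)} (hB : B ≤ depthSubgroup (G →* ℂˣ) n m) : IsCyclic B := by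
  obtain ⟨e⟩ := CommGroup.monoidHom_mulEquiv_of_hasEnoughRootsOfUnity G ℂ
  have hmem (x : B) : e x ∈ G₁ := by
    have hx : e x ∈ depthSubgroup G n m := map_mem_depthSubgroup n e.toMonoidHom (hB x.2)
    have hex : (e x) ^ (n ^ m) = 1 := by
      rw [mem_depthSubgroup, neg_pow] at hx
      rcases neg_one_pow_eq_or ℤ m with h | h
      · rw [h, one_mul] at hx
        exact_mod_cast hx
      · rw [h, neg_one_mul, zpow_neg, inv_eq_one] at hx
        exact_mod_cast hx
    obtain ⟨y₁, hy₁, y₂, hy₂, hy⟩ := Subgroup.mem_sup.1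
      (show e x ∈ G₁ ⊔ G₂ by rw [hG.sup_eq_top]; trivial)
    have hy₂1 : y₂ ^ (n ^ m) = 1 := by
      rw [← hy, mul_pow, mul_eq_one_iff_eq_inv'] at hex
      refine Subgroup.disjoint_def.1 hG.disjoint ?_ (G₂.pow_mem hy₂ _)
      rw [hex]
      exact G₁.inv_mem (G₁.pow_mem hy₁ _)
    have hy₂2 : y₂ ^ Nat.card G₂ = 1 := by
      have := pow_card_eq_one' (x := (⟨y₂, hy₂⟩ : G₂))
      exact congrArg Subtype.val this
    have : orderOf y₂ = 1 := Nat.eq_one_of_dvd_coprimes (hG₂.pow_right m)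
      (orderOf_dvd_of_pow_eq_one hy₂2) (orderOf_dvd_of_pow_eq_one hy₂1)
    rw [orderOf_eq_one_iff] at this
    rw [← hy, this, mul_one]
    exact hy₁
  exact isCyclic_of_injective ((e.toMonoidHom.comp B.subtype).codRestrict G₁ hmem)
    fun x y hxy => Subtype.ext (e.injective (congrArg Subtype.val hxy))

/-! ### Construction of the simple polynomial -/

theorem bijOn_weightStep {A : Type*} [CommGroup A] {a : A} {n : ℕ} {Z : Set A} (hZ : Z.Finite)
    (hmaps : Set.MapsTo (weightStep a n) Z Z)
    (hper : ∀ z ∈ Z, z ∈ Function.periodicPts (weightStep a n)) :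
    Set.BijOn (weightStep a n) Z Z :=
  (hZ.injOn_iff_bijOn_of_mapsTo hmaps).1
    ((Function.bijOn_periodicPts (f := weightStep a n)).injOn.mono hper)

/-- Let the weights `w i` of `G` differ from `z i` by powers of `β`, and let `c` be a character,
possibly of an extension `Γ` of `G`, that is fixed by `weightStep`. The chain that starts at `c β`
ends at `c`, and gives a component of type `T_{m+1}`; it separates elements as well as all the
`w i / z i` together. -/
theorem exists_simple_of_fixed_point {d : ℕ} (hd : 1 ≤ d) {G Γ : Type*} [CommGroup G]
    [CommGroup Γ] (π : Γ →* G) (a : G →* ℂˣ) {N : ℕ} (w z : Fin N → (G →* ℂˣ)) {m : ℕ}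
    (hm : 1 ≤ m) {β : G →* ℂˣ} (hβ : β ∈ depthSubgroup (G →* ℂˣ) (d - 1) m)
    (hwz : ∀ i, w i / z i ∈ Subgroup.zpowers β) {Z : Set (Γ →* ℂˣ)} (hZ : Z.Finite)
    (hTZ : Set.BijOn (weightStep (a.comp π) (d - 1)) Z Z) {c : Γ →* ℂˣ}
    (hc : weightStep (a.comp π) (d - 1) c = c)
    (hzc : ∀ i, (z i).comp π = c ∨ (z i).comp π ∈ Z)
    (hinj : ∀ γ (u : ℂˣ), (∀ i, w i (π γ) = u) → c γ = u → γ = 1) :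
    ∃ (F₀ : MvPolynomial (Fin (Z.ncard + 1 * (m + 1))) ℂ) (s : ℕ) (τ : Fin s → ComponentType),
      IsSimpleOfType d τ F₀ ∧ numTGeTwo τ = 1 ∧
      ∃ φ : Γ →* diagAut F₀, Function.Injective φ := by
  have hchain : (weightStep (a.comp π) (d - 1))^[m] (c * β.comp π) = c :=
    iterate_weightStep_mul_of_fixed hc
      (map_mem_depthSubgroup (d - 1) (MonoidHom.compHom' π : (G →* ℂˣ) →* (Γ →* ℂˣ)) hβ)
  refine exists_simple_of_invariant_set hd (a.comp π) Z hZ hTZ 1 m hm (c * β.comp π)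
    (fun _ => by rw [hchain, hc]) fun γ u hγ hγ' => ?_
  replace hγ' := hγ' one_ne_zero
  have h1 : c γ = u := by
    have := hγ' m le_rfl
    rwa [hchain] at this
  have h2 : β (π γ) = 1 := by
    have h0 : c γ * β (π γ) = u := hγ' 0 (Nat.zero_le m)
    rwa [h1, mul_eq_left] at h0
  refine hinj γ u (fun i => ?_) h1
  have h3 : z i (π γ) = u := by
    rcases hzc i with h | h
    · rw [← h1, ← h]; rfl
    · exact hγ _ h
  obtain ⟨k, hk⟩ := Subgroup.mem_zpowers_iff.1 (hwz i)
  have h4 : w i (π γ) / z i (π γ) = 1 := by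
    have := DFunLike.congr_fun hk (π γ)
    simpa [h2] using this.symm
  rw [div_eq_one.1 h4, h3]

/-- The extension of `G` formed by the pairs of an element of `G` and a `d`-th root of its value
under `a`. On it, `a` becomes the `d`-th power of the second projection, which is therefore fixed
by `weightStep`. -/
def rootExtension {G : Type*} [CommGroup G] (a : G →* ℂˣ) (d : ℕ) : Subgroup (G × ℂˣ) :=
  ((powMonoidHom d).comp (MonoidHom.snd G ℂˣ)).eqLocus (a.comp (MonoidHom.fst G ℂˣ))

theorem mem_rootExtension {G : Type*} [CommGroup G] {a : G →* ℂˣ} {d : ℕ} {p : G × ℂˣ} :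
    p ∈ rootExtension a d ↔ p.2 ^ d = a p.1 := Iff.rfl

theorem finite_rootExtension {G : Type*} [CommGroup G] [Finite G] (a : G →* ℂˣ) {d : ℕ}
    (hd : d ≠ 0) : Finite (rootExtension a d) := by
  have : NeZero (d * Nat.card G) := ⟨mul_ne_zero hd Nat.card_pos.ne'⟩
  refine Finite.of_injective (fun p : rootExtension a d =>
    ((p.1.1, ⟨p.1.2, ?_⟩) : G × rootsOfUnity (d * Nat.card G) ℂ)) fun p q hpq => ?_
  · rw [mem_rootsOfUnity, pow_mul, mem_rootExtension.1 p.2, ← map_pow, pow_card_eq_one', map_one]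
  · have h := Prod.ext_iff.1 hpq
    exact Subtype.ext (Prod.ext h.1 (congrArg Subtype.val h.2))

theorem exists_pow_eq_units {d : ℕ} (hd : d ≠ 0) (u : ℂˣ) : ∃ v : ℂˣ, v ^ d = u := by
  obtain ⟨x, hx⟩ := IsAlgClosed.exists_pow_nat_eq (u : ℂ) (Nat.pos_of_ne_zero hd)
  have hx0 : x ≠ 0 := by
    rintro rfl
    rw [zero_pow hd] at hx
    exact u.ne_zero hx.symm
  exact ⟨Units.mk0 x hx0, Units.ext (by simpa using hx)⟩

end SmoothHypersurface

theorem theorem4p3 (d N : ℕ) (hd : 3 ≤ d) (hN : 3 ≤ N)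
    (G : Type*) [CommGroup G] [Finite G]
    (F : MvPolynomial (Fin N) ℂ) (hFd : F.IsHomogeneous d)
    (hF : SmoothHypersurface.IsSmooth F)
    (ρ : G →* SmoothHypersurface.linAut F) (hρ : Function.Injective ρ)
    (hlift : SmoothHypersurface.IsLiftable ((SmoothHypersurface.linAut F).subtype.comp ρ))
    (G₁ G₂ : Subgroup G) (hG : IsCompl G₁ G₂) (hG₁ : IsCyclic G₁)
    (hG₂ : (Nat.card G₂).Coprime (d - 1)) :
    ∃ N₀ : ℕ, 1 ≤ N₀ ∧ N₀ ≤ N ∧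
      ∃ (F₀ : MvPolynomial (Fin N₀) ℂ) (s : ℕ) (τ : Fin s → SmoothHypersurface.ComponentType),
        SmoothHypersurface.IsSimpleOfType d τ F₀ ∧
        SmoothHypersurface.numTGeTwo τ ≤ 1 ∧
        ((Nat.card G).gcd (d - 1) ≠ 1 → SmoothHypersurface.numTGeTwo τ = 1) ∧
        ∃ φ : G →* SmoothHypersurface.diagAut F₀, Function.Injective φ := by
  open SmoothHypersurface in
  obtain ⟨j, hj⟩ := hlift
  have hjρ (g : G) : Matrix.ProjGenLinGroup.mk (j g) = (ρ g : PGL(N, ℂ)) := DFunLike.congr_fun hj g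
  obtain ⟨F₁, w, a, hF₁d, hF₁, hwa, hinj⟩ := exists_weights (by omega) (by omega) hFd hF j
    (fun g => by rw [hjρ]; exact (ρ g).2)
    fun g hg => hρ (Subtype.ext (by rw [← hjρ, hg, map_one]; rfl))
  obtain ⟨z, m, hper, hstep, hdepth, hcount⟩ := exists_periodic_limits (a := a) (n := d - 1) w
    fun K v => hF₁.card_weights_le (by omega) hF₁d w a hwa K v
  have hZ : (Set.range z).Finite := Set.toFinite _
  have hmaps : Set.MapsTo (weightStep a (d - 1)) (Set.range z) (Set.range z) := by
    rintro _ ⟨i, rfl⟩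
    exact hstep i
  have hTZ := bijOn_weightStep hZ hmaps (by rintro _ ⟨i, rfl⟩; exact hper i)
  rcases Nat.eq_zero_or_pos m with rfl | hm
  · -- All weights are periodic, and the cycles through them suffice.
    have hwz (i) : w i = z i := by
      have := (mem_depthSubgroup _).1 (hdepth i)
      rwa [pow_zero, zpow_one, div_eq_one] at this
    obtain ⟨F₀, s, τ, h1, h2, h3⟩ := exists_simple_of_invariant_set (d := d) (by omega) a
      (Set.range z) hZ hTZ 0 1 le_rfl 1 (fun h => absurd rfl h) fun g c hg _ =>
        hinj g c fun i => by rw [hwz]; exact hg _ ⟨i, rfl⟩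
    refine ⟨_, ?_, ?_, F₀, s, τ, h1, h2.trans_le zero_le_one, fun hgcd => ?_, h3⟩
    · have : 0 < (Set.range z).ncard := (Set.ncard_pos hZ).2 ⟨_, ⟨⟨0, by omega⟩, rfl⟩⟩
      omega
    · have := Set.ncard_image_le (f := z) (s := Set.univ)
      rw [Set.image_univ, Set.ncard_univ, Nat.card_eq_fintype_card, Fintype.card_fin] at this
      omega
    · -- An element whose order divides `d - 1` would act through the scalars `a g`.
      exfalso
      obtain ⟨p, hp, hpd⟩ := Nat.exists_prime_and_dvd hgcd
      have : Fact p.Prime := ⟨hp⟩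
      obtain ⟨g, hg⟩ := exists_prime_orderOf_dvd_card' p (hpd.trans (Nat.gcd_dvd_left _ _))
      have hgd : g ^ (d - 1) = 1 :=
        orderOf_dvd_iff_pow_eq_one.1 (hg ▸ hpd.trans (Nat.gcd_dvd_right _ _))
      have hg1 : g = 1 := hinj g (a g) fun i => by
        obtain ⟨_, ⟨k, rfl⟩, hk⟩ := hTZ.surjOn ⟨i, rfl⟩
        rw [hwz, ← hk, weightStep, MonoidHom.div_apply, MonoidHom.pow_apply, ← map_pow, hgd,
          map_one, div_one]
      rw [hg1, orderOf_one] at hg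
      exact hp.one_lt.ne hg
  · obtain ⟨i, hi1, hi2⟩ := hcount hm.ne'
    -- The quotients `w i / z i` generate a cyclic group, with generator `β`.
    have hB : Subgroup.closure (Set.range fun i => w i / z i) ≤
        depthSubgroup (G →* ℂˣ) (d - 1) m := by
      rw [Subgroup.closure_le]
      rintro _ ⟨i, rfl⟩
      exact hdepth i
    obtain ⟨⟨β, hβ⟩, hgen⟩ := (isCyclic_of_le_depthSubgroup hG hG₁ hG₂ hB).exists_generator
    have hwz (i) : w i / z i ∈ Subgroup.zpowers β := by
      obtain ⟨k, hk⟩ := Subgroup.mem_zpowers_iff.1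
        (hgen ⟨w i / z i, Subgroup.subset_closure ⟨i, rfl⟩⟩)
      exact Subgroup.mem_zpowers_iff.2 ⟨k, congrArg Subtype.val hk⟩
    by_cases hfix : weightStep a (d - 1) (z i) = z i
    · -- The attracting point is fixed: the chain takes its place among the components.
      have hZ' : (Set.range z \ {z i}).Finite := hZ.subset Set.sdiff_subset
      have hTZ' : Set.BijOn (weightStep a (d - 1)) (Set.range z \ {z i})
          (Set.range z \ {z i}) := by
        refine bijOn_weightStep hZ' (fun x hx => ⟨hmaps hx.1, fun h => hx.2 ?_⟩) ?_
        · exact hTZ.injOn hx.1 ⟨i, rfl⟩ ((Set.mem_singleton_iff.1 h).trans hfix.symm)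
        · rintro _ ⟨⟨k, rfl⟩, -⟩
          exact hper k
      obtain ⟨F₀, s, τ, h1, h2, h3⟩ := exists_simple_of_fixed_point (d := d) (by omega)
        (MonoidHom.id G) a w z hm (hB hβ) hwz hZ' hTZ' (c := z i) hfix
        (fun k => by
          by_cases hk : z k = z i
          · exact Or.inl hk
          · exact Or.inr ⟨⟨k, rfl⟩, hk⟩)
        fun g u hg _ => hinj g u hg
      refine ⟨_, ?_, ?_, F₀, s, τ, h1, h2.le, fun _ => h2, h3⟩
      · omega
      · have := Set.ncard_sdiff_singleton_add_one (Set.mem_range_self (f := z) i) hZ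
        omega
    · -- The orbit of the attracting point is not a fixed point, and leaves room for a further
      -- chain. Its end is the tautological character of the extension of `G` by `d`-th roots.
      let Γ := rootExtension a d
      have : Finite Γ := finite_rootExtension a (by omega)
      let π : Γ →* G := (MonoidHom.fst G ℂˣ).comp Γ.subtype
      let c : Γ →* ℂˣ := (MonoidHom.snd G ℂˣ).comp Γ.subtype
      have hπ : Function.Surjective π := fun g => by
        obtain ⟨u, hu⟩ := exists_pow_eq_units (d := d) (by omega) (a g)
        exact ⟨⟨(g, u), hu⟩, rfl⟩
      have hc : weightStep (a.comp π) (d - 1) c = c := by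
        ext1 γ
        change a γ.1.1 / γ.1.2 ^ (d - 1) = γ.1.2
        rw [← mem_rootExtension.1 γ.2, div_eq_iff_eq_mul, ← pow_succ', Nat.sub_add_cancel (by omega)]
      have hZ' : ((fun x : G →* ℂˣ => x.comp π) '' Set.range z).Finite := hZ.image _
      have hTZ' : Set.BijOn (weightStep (a.comp π) (d - 1))
          ((fun x : G →* ℂˣ => x.comp π) '' Set.range z)
          ((fun x : G →* ℂˣ => x.comp π) '' Set.range z) := by
        have hcomm : Function.Semiconj (fun x : G →* ℂˣ => x.comp π) (weightStep a (d - 1))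
            (weightStep (a.comp π) (d - 1)) := fun x => rfl
        refine bijOn_weightStep hZ' ?_ ?_
        · rintro _ ⟨x, hx, rfl⟩
          exact ⟨_, hmaps hx, hcomm x⟩
        · rintro _ ⟨_, ⟨k, rfl⟩, rfl⟩
          exact hcomm.mapsTo_periodicPts (hper k)
      obtain ⟨F₀, s, τ, h1, h2, φ, hφ⟩ := exists_simple_of_fixed_point (d := d) (by omega)
        π a w z hm (hB hβ) hwz hZ' hTZ' hc (fun k => Or.inr ⟨_, ⟨k, rfl⟩, rfl⟩)
        fun γ u hγ hγc => by
          have hγ1 : γ.1.1 = 1 := hinj _ u hγ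
          have hu : u = 1 := by
            rw [← hγ ⟨0, by omega⟩, show π γ = 1 from hγ1, map_one]
          exact Subtype.ext (Prod.ext hγ1 (hγc.trans hu))
      obtain ⟨ψ, hψ⟩ := exists_injective_of_surjective π hπ
      refine ⟨_, ?_, ?_, F₀, s, τ, h1, h2.le, fun _ => h2, φ.comp ψ, hφ.comp hψ⟩
      · omega
      · have := Set.ncard_image_le (f := fun x : G →* ℂˣ => x.comp π) hZ
        have := hi2 hfix
        omega
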